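/- Let $\Bbbk$ be a field of characteristic $0$, let $I$ be a finite set and let $w$ be a simple graph with vertex set $I$. Write $[n]=\{1,\dots,n\}$. For $S\subseteq I$ and $T=I\setminus S$, let $w_{|S}$ be the subgraph of $w$ induced by $S$, and let $w_{/S}$ be the simple graph on $T$ in which distinct $u,v$ are adjacent if and only if $w$ contains a path from $u$ to $v$ all of whose vertices other than $u,v$ lie in $S$. Let $W[I]$ be the $\Bbbk$-vector space with basis the simple graphs on $I$, with coproduct $\Delta_{S,T}:W[I]\to W[S]\otimes W[T]$, $w\mapsto w_{|S}\otimes w_{/S}$, and its iterates $\Delta_{S_1,\dots,S_n}$. Let $\zeta_I:W[I]\to\Bbbk$ be the linear map sending the graph without edges to $1$ and all other simple graphs to $0$. For $n\in\mathbb N$ put $$\chi^W_I(w)(n)=\sum_{S_1\sqcup\dots\sqcup S_n=I}(\zeta_{S_1}\otimes\dots\otimes\zeta_{S_n})\circ\Delta_{S_1,\dots,S_n}(w),$$ where the sum is over all ordered decompositions of $I$ into $n$ possibly empty parts. A *coloring with $[n]$* is a map $c:I\to[n]$. A *partitioning tree* of a connected simple graph on a vertex set $J$ is a rooted tree with vertex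 set $J$, defined recursively: its root is some $v\in J$, and the subtrees rooted at the children of $v$ are partitioning trees, exactly one for each connected component of the subgraph induced by $J\setminus\{v\}$ (none if $J=\{v\}$). A *partitioning forest* of $w$ is a disjoint union of partitioning trees, one for each connected component of $w$. A partitioning forest and a coloring $c$ are *compatible* if $c(x)\le c(y)$ whenever $y$ is the parent of $x$, and *strictly compatible* if $c(x)<c(y)$ whenever $y$ is the parent of $x$. Then $\chi^W_I(w)(n)$ is the value at $n\in\mathbb{N}$ of a (unique) polynomial with coefficients in $\Bbbk$, also denoted $\chi^W_I(w)$, and for every integer $n\ge 0$: 1. $\chi^W_I(w)(n)$ is the number of colorings of $w$ with $[n]$ such that every path of $w$ with two distinct ends of the same color has a vertex of color strictly greater than the color of its ends; 2. $\chi^W_I(w)(n)$ is also the number of strictly compatible pairs of a partitioning forest of $w$ and a coloring with $[n]$; 3. $(-1)^{|I|}\chi^W_I(w)(-n)$ is the number of compatible pairs of a partitioning forest of $w$ and a coloring with $[n]$. In particular, $(-1)^{|I|}\chi^W_I(w)(-1)$ is the number of partitioning forests of $w$; if $w$ is connected, it is the number of partitioning trees of $w$. -/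

import Mathlib

open scoped TensorProduct

namespace GraphHopf

noncomputable section

/-! ### The Hopf monoid `W` of simple graphs and its basic invariant -/

/-- The space `W[I]`: the free vector space on the simple graphs with vertex set `I`. -/
abbrev W (𝕜 : Type*) [Field 𝕜] (I : Type*) : Type _ := SimpleGraph I →₀ 𝕜

/-- The restriction `w_{|S}` (ripping out the complement of `S`):
the subgraph of `w` induced by `S`. -/
def rip {I : Type*} (w : SimpleGraph I) (S : Set I) : SimpleGraph S := w.induce S

/-- The contraction `w_{/S}` (sewing through `S`): the simple graph on the complement of `S` with
an edge between `u ≠ v` when `w` has a path from `u` to `v` all of whose vertices other than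
the two ends lie in `S`. -/
def sew {I : Type*} (w : SimpleGraph I) (S : Set I) : SimpleGraph (Sᶜ : Set I) where
  Adj u v := u ≠ v ∧ ∃ p : w.Walk (u : I) (v : I), p.IsPath ∧
    ∀ x ∈ p.support, x ≠ (u : I) → x ≠ (v : I) → x ∈ S
  symm := ⟨by
    rintro u v ⟨hne, p, hp, h⟩
    refine ⟨hne.symm, p.reverse, hp.reverse, fun x hx h1 h2 => h x ?_ h2 h1⟩
    simpa using hx⟩
  loopless := ⟨fun _ h => h.1 rfl⟩

/-- The coproduct `Δ_{S,T} : W[I] → W[S] ⊗ W[T]`, where `T` is the complement of `S` in `I`: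
the linear map with `w ↦ w_{|S} ⊗ w_{/S}` on simple graphs. -/
def coprod (𝕜 : Type*) [Field 𝕜] {I : Type*} (S : Set I) :
    W 𝕜 I →ₗ[𝕜] W 𝕜 S ⊗[𝕜] W 𝕜 (Sᶜ : Set I) :=
  Finsupp.lift _ 𝕜 (SimpleGraph I)
    (fun w => Finsupp.single (rip w S) 1 ⊗ₜ[𝕜] Finsupp.single (sew w S) 1)

open Classical in
/-- The basic character `ζ_I : W[I] → 𝕜`: it sends discrete graphs (no edges) to `1` and
all other simple graphs to `0`. -/
def zeta (𝕜 : Type*) [Field 𝕜] (I : Type*) : W 𝕜 I →ₗ[𝕜] 𝕜 :=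
  Finsupp.lift 𝕜 𝕜 (SimpleGraph I) (fun w => if w = ⊥ then 1 else 0)

/-- The functional `(ζ_{S₁} ⊗ ⋯ ⊗ ζ_{Sₙ}) ∘ Δ_{S₁,…,Sₙ}` on `W[I]`, for the decomposition
`S_{i+1} = f⁻¹(i)` of `I` given by `f : I → Fin n`. The iterated coproduct is
`Δ_{S₁,…,Sₙ} = (id ⊗ Δ_{S₂,…,Sₙ}) ∘ Δ_{S₁, S₂ ⊔ ⋯ ⊔ Sₙ}`; for `n = 0` the set `I` is empty,
`W[∅] = 𝕜`, and the functional is the identity of `𝕜`, that is `ζ_∅`. -/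
def zetaCoprod (𝕜 : Type*) [Field 𝕜] :
    (n : ℕ) → {I : Type*} → (I → Fin n) → (W 𝕜 I →ₗ[𝕜] 𝕜)
  | 0, I, _ => zeta 𝕜 I
  | n + 1, I, f =>
    LinearMap.mul' 𝕜 𝕜 ∘ₗ
      TensorProduct.map (zeta 𝕜 {x : I | f x = 0})
        (zetaCoprod 𝕜 n (fun x : ({x : I | f x = 0}ᶜ : Set I) => (f x).pred x.2)) ∘ₗ
      coprod 𝕜 {x : I | f x = 0}

/-- The basic invariant at a natural number:
`χ_I(x)(n) = ∑_{(S₁,…,Sₙ) ⊢ I} (ζ_{S₁} ⊗ ⋯ ⊗ ζ_{Sₙ}) (Δ_{S₁,…,Sₙ}(x))`, the sum being over all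
decompositions of `I` into `n` possibly empty parts, i.e. over all maps `I → Fin n`. -/
def basicInvariant (𝕜 : Type*) [Field 𝕜] {I : Type*} [Fintype I] [DecidableEq I]
    (x : W 𝕜 I) (n : ℕ) : 𝕜 :=
  ∑ f : I → Fin n, zetaCoprod 𝕜 n f x

end

/-! ### Colorings

A coloring with `[n]` is a map `I → Fin n`; the order of `Fin n` is that of `{1, …, n}`. -/

/-- Every path with two distinct ends of the same color has a vertex whose color is strictly
greater than the color of the ends (such a vertex is necessarily an interior one). -/
def IsPathColoring {I : Type*} (w : SimpleGraph I) {n : ℕ} (c : I → Fin n) : Prop :=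
  ∀ (u v : I) (p : w.Walk u v), p.IsPath → u ≠ v → c u = c v → ∃ x ∈ p.support, c u < c x

/-! ### Partitioning trees and forests

A rooted forest with vertex set `I` is given by its parent function `I → Option I`, which sends
each root to `none`. -/

/-- `K` is the vertex set of a connected component of the induced subgraph `w_{|A}`. -/
def IsComponent {I : Type*} (w : SimpleGraph I) (A K : Set I) : Prop :=
  ∃ C : (w.induce A).ConnectedComponent, K = Subtype.val '' C.supp

/-- `IsTreeOn w parent q J`: the restriction of `parent` to `J` describes a partitioning tree
of `w_{|J}`, and `parent` sends the root of that tree to `q` (which is `none` or a vertex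
outside of `J`).
Such a tree consists of a root `v ∈ J` and a partitioning tree for each connected component of
`w_{|J \ {v}}`, whose root is a child of `v`. If `J = {v}`, there are no such components and the
tree is the single vertex `v`. -/
inductive IsTreeOn {I : Type*} (w : SimpleGraph I) (parent : I → Option I) :
    Option I → Set I → Prop
  | node (q : Option I) (J : Set I) (v : I) (hv : v ∈ J) (hroot : parent v = q)
      (hsub : ∀ K : Set I, IsComponent w (J \ {v}) K → IsTreeOn w parent (some v) K) :
      IsTreeOn w parent q J

/-- `parent` describes a partitioning tree of `w` (a notion for connected `w`). -/
def IsPartitioningTree {I : Type*} (w : SimpleGraph I) (parent : I → Option I) : Prop :=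
  IsTreeOn w parent none Set.univ

/-- `parent` describes a partitioning forest of `w`: a disjoint union of partitioning trees, one
for each connected component of `w`. -/
def IsPartitioningForest {I : Type*} (w : SimpleGraph I) (parent : I → Option I) : Prop :=
  ∀ K : Set I, IsComponent w Set.univ K → IsTreeOn w parent none K

/-- Compatibility of a rooted forest, oriented towards the parents, and a coloring: on every edge
the parent has maximal color. -/
def Compatible {I : Type*} {n : ℕ} (parent : I → Option I) (c : I → Fin n) : Prop :=
  ∀ x v : I, parent x = some v → c x ≤ c v

/-- Strict compatibility: on every edge the parent is the unique vertex of maximal color. -/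
def StrictlyCompatible {I : Type*} {n : ℕ} (parent : I → Option I) (c : I → Fin n) : Prop :=
  ∀ x v : I, parent x = some v → c x < c v

end GraphHopf

/-! Contracting `S` does not change which vertices are connected inside a set containing `S`
(`connIn_sew_iff`). Hence, peeling off the color classes from the lowest one, the term of a coloring
in the basic invariant is `1` if no two distinct vertices of equal color are connected through
vertices of at most that color, and `0` otherwise (`zetaCoprod_single`).

For such a coloring a connected set has a unique vertex of maximal color, since two of them would be
joined inside the set. It must be the root of any strictly compatible tree; removing it and
recursing gives exactly one strictly compatible forest (`ncard_isPathColoring`). So the invariant is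
the sum, over partitioning forests, of the number of strictly compatible colorings.

Reciprocity then holds forest by forest (`exists_polynomial_homSum`). Summing out the color of a
leaf with weight `h` multiplies the weight of its parent by the antidifference `H` of `h`, so the
induction needs polynomial weights. If `H(0) = 0`, the sum of `h(k)` over `k < b` is `H(b)`, and the
sum of `h(-1-k)` over `k ≤ b` is `-H(-1-b)`: passing to weak inequalities and reflected weights
costs one sign per vertex. -/

namespace GraphHopf

/-! ### Walks inside a set of vertices -/

/-- Some walk of `w` from `u` to `v` has all its vertices in `A`. -/
def ConnIn {I : Type*} (w : SimpleGraph I) (A : Set I) (u v : I) : Prop :=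
  ∃ p : w.Walk u v, ∀ x ∈ p.support, x ∈ A

section ConnIn

variable {I : Type*} {w : SimpleGraph I} {A B : Set I} {u v x : I}

lemma ConnIn.refl (h : u ∈ A) : ConnIn w A u u := ⟨.nil, by simpa using h⟩

lemma ConnIn.symm : ConnIn w A u v → ConnIn w A v u := by
  rintro ⟨p, hp⟩
  exact ⟨p.reverse, by simpa using hp⟩

lemma ConnIn.trans : ConnIn w A u v → ConnIn w A v x → ConnIn w A u x := by
  rintro ⟨p, hp⟩ ⟨q, hq⟩
  refine ⟨p.append q, fun y hy => ?_⟩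
  rcases (SimpleGraph.Walk.mem_support_append_iff p q).1 hy with h | h
  exacts [hp y h, hq y h]

lemma ConnIn.mono (h : A ⊆ B) : ConnIn w A u v → ConnIn w B u v := by
  rintro ⟨p, hp⟩
  exact ⟨p, fun x hx => h (hp x hx)⟩

lemma ConnIn.mem_left : ConnIn w A u v → u ∈ A := by
  rintro ⟨p, hp⟩
  exact hp _ p.start_mem_support

lemma ConnIn.mem_right (h : ConnIn w A u v) : v ∈ A := h.symm.mem_left

lemma ConnIn.of_adj (h : w.Adj u v) (hu : u ∈ A) (hv : v ∈ A) : ConnIn w A u v :=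
  ⟨h.toWalk, by simp [hu, hv]⟩

lemma connIn_of_mem_support {p : w.Walk u v} (hp : ∀ x ∈ p.support, x ∈ A)
    (hx : x ∈ p.support) : ConnIn w A u x := by
  classical
  exact ⟨p.takeUntil x hx, fun y hy => hp y (p.support_takeUntil_subset_support hx hy)⟩

/-- A walk inside `A` stays in one class of `ConnIn w A`. -/
lemma ConnIn.setOf (h : ConnIn w A u v) (hx : ConnIn w A x u) :
    ConnIn w {y | ConnIn w A x y} u v := by
  obtain ⟨p, hp⟩ := h
  exact ⟨p, fun y hy => hx.trans (connIn_of_mem_support hp hy)⟩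

/-- Replaces components of induced subgraphs by walks of `w` itself, so that nested components need
no nested subtypes. -/
lemma isComponent_iff {K : Set I} :
    IsComponent w A K ↔ ∃ x ∈ A, K = {y | ConnIn w A x y} := by
  have key (a b : A) : (w.induce A).Reachable a b ↔ ConnIn w A a b := by
    constructor
    · rintro ⟨p⟩
      refine ⟨p.map (SimpleGraph.Embedding.induce A).toHom, fun x hx => ?_⟩
      change x ∈ (p.map (SimpleGraph.Embedding.induce A).toHom).support at hx
      rw [SimpleGraph.Walk.support_map] at hx
      obtain ⟨z, -, rfl⟩ := List.mem_map.1 hx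
      exact z.2
    · rintro ⟨p, hp⟩
      exact ⟨p.induce A hp⟩
  constructor
  · rintro ⟨C, rfl⟩
    induction C using SimpleGraph.ConnectedComponent.ind with | _ a
    refine ⟨a, a.2, Set.ext fun y => ?_⟩
    simp only [Set.mem_image, SimpleGraph.ConnectedComponent.mem_supp_iff,
      SimpleGraph.ConnectedComponent.eq, Set.mem_ofPred_eq]
    constructor
    · rintro ⟨b, hb, rfl⟩
      exact (key _ _).1 hb.symm
    · intro h
      exact ⟨⟨y, h.mem_right⟩, ((key a ⟨y, h.mem_right⟩).2 h).symm, rfl⟩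
  · rintro ⟨x, hx, rfl⟩
    refine ⟨(w.induce A).connectedComponentMk ⟨x, hx⟩, Set.ext fun y => ?_⟩
    simp only [Set.mem_image, SimpleGraph.ConnectedComponent.mem_supp_iff,
      SimpleGraph.ConnectedComponent.eq, Set.mem_ofPred_eq]
    constructor
    · intro h
      exact ⟨⟨y, h.mem_right⟩, ((key ⟨x, hx⟩ ⟨y, h.mem_right⟩).2 h).symm, rfl⟩
    · rintro ⟨b, hb, rfl⟩
      exact (key ⟨x, hx⟩ b).1 hb.symm

lemma isComponent_setOf (hx : x ∈ A) : IsComponent w A {y | ConnIn w A x y} :=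
  isComponent_iff.2 ⟨x, hx, rfl⟩

lemma IsComponent.subset {K : Set I} (h : IsComponent w A K) : K ⊆ A := by
  obtain ⟨x, -, rfl⟩ := isComponent_iff.1 h
  exact fun y hy => ConnIn.mem_right hy

lemma IsComponent.nonempty {K : Set I} (h : IsComponent w A K) : K.Nonempty := by
  obtain ⟨x, hx, rfl⟩ := isComponent_iff.1 h
  exact ⟨x, .refl hx⟩

lemma IsComponent.connIn {K : Set I} (h : IsComponent w A K) (hu : u ∈ K) (hv : v ∈ K) :
    ConnIn w K u v := by
  obtain ⟨x, -, rfl⟩ := isComponent_iff.1 h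
  exact (ConnIn.trans (ConnIn.symm hu) hv).setOf hu

lemma IsComponent.eq_setOf {K : Set I} (h : IsComponent w A K) (hu : u ∈ K) :
    K = {y | ConnIn w A u y} := by
  obtain ⟨x, -, rfl⟩ := isComponent_iff.1 h
  exact Set.ext fun y => ⟨fun hy => (ConnIn.symm hu).trans hy, fun hy => ConnIn.trans hu hy⟩

/-- A walk inside `A` lies in a component of `w_{|A}`. -/
lemma exists_isComponent (p : w.Walk u v) (hp : ∀ x ∈ p.support, x ∈ A) :
    ∃ K, IsComponent w A K ∧ ∀ x ∈ p.support, x ∈ K :=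
  ⟨_, isComponent_setOf (hp u p.start_mem_support), fun _ hx => connIn_of_mem_support hp hx⟩

end ConnIn

/-! ### The basic character on iterated coproducts -/

section Sew

variable {I : Type*} {w : SimpleGraph I} {S A : Set I}

/-- Walks may replace paths, since bypassing loops only shrinks the support. -/
lemma isPathColoring_iff {n : ℕ} {c : I → Fin n} :
    IsPathColoring w c ↔ ∀ u v, u ≠ v → c u = c v → ¬ ConnIn w {x | c x ≤ c u} u v := by
  classical
  constructor
  · rintro h u v hne huv ⟨p, hp⟩
    obtain ⟨x, hx, hlt⟩ := h u v p.bypass p.bypass_isPath hne huv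
    exact hlt.not_ge (hp x (p.support_bypass_subset_support hx))
  · intro h u v p _ hne huv
    by_contra! hx
    exact h u v hne huv ⟨p, hx⟩

lemma sew_adj {u v : (Sᶜ : Set I)} :
    (sew w S).Adj u v ↔ u ≠ v ∧ ConnIn w (S ∪ {(u : I), (v : I)}) u v := by
  classical
  refine and_congr_right fun _ => ⟨?_, ?_⟩
  · rintro ⟨p, -, hp⟩
    refine ⟨p, fun x hx => ?_⟩
    have := hp x hx
    simp only [Set.mem_union, Set.mem_insert_iff, Set.mem_singleton_iff]
    tauto
  · rintro ⟨p, hp⟩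
    refine ⟨p.bypass, p.bypass_isPath, fun x hx h1 h2 => ?_⟩
    have := hp x (p.support_bypass_subset_support hx)
    simp only [Set.mem_union, Set.mem_insert_iff, Set.mem_singleton_iff] at this
    tauto

lemma ConnIn.of_sew (hS : S ⊆ A) {u v : (Sᶜ : Set I)}
    (h : ConnIn (sew w S) (Subtype.val ⁻¹' A) u v) : ConnIn w A u v := by
  obtain ⟨p, hp⟩ := h
  induction p with
  | nil => exact .refl (hp _ (by simp))
  | @cons a b d hab q ih =>
    have ha : (a : I) ∈ A := hp a (by simp)
    have hb : (b : I) ∈ A := hp b (by simp)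
    refine .trans ((sew_adj.1 hab).2.mono ?_) (ih fun x hx => hp x (by simp [hx]))
    rintro x (hx | rfl | rfl)
    exacts [hS hx, ha, hb]

/-- The start `a` may lie in `S`, which makes induction on the walk possible; `b` is the first
vertex outside `S` after `a`, or `v` itself for the trivial walk. -/
lemma exists_connIn_sew {a v : I} (p : w.Walk a v) (hp : ∀ x ∈ p.support, x ∈ A) (hv : v ∈ Sᶜ) :
    ∃ b : (Sᶜ : Set I), ConnIn w (S ∪ {a, (b : I)}) a b ∧
      ConnIn (sew w S) (Subtype.val ⁻¹' A) b ⟨v, hv⟩ := by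
  induction p with
  | nil => exact ⟨⟨_, hv⟩, .refl (by simp), .refl (hp _ (by simp))⟩
  | @cons a a' v haa q ih =>
    obtain ⟨b, hb, hbv⟩ := ih (fun x hx => hp x (by simp [hx])) hv
    by_cases ha : a' ∈ S
    · refine ⟨b, (ConnIn.of_adj haa (by simp) (.inl ha)).trans (hb.mono ?_), hbv⟩
      rintro x (hx | rfl | rfl)
      exacts [.inl hx, .inl ha, by simp]
    · refine ⟨⟨a', ha⟩, .of_adj haa (by simp) (by simp), ?_⟩
      by_cases hab : (⟨a', ha⟩ : (Sᶜ : Set I)) = b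
      · rwa [hab]
      · exact .trans (.of_adj (sew_adj.2 ⟨hab, hb⟩) (hp a' (by simp)) hbv.mem_left) hbv

lemma connIn_sew_iff (hS : S ⊆ A) {u v : (Sᶜ : Set I)} :
    ConnIn (sew w S) (Subtype.val ⁻¹' A) u v ↔ ConnIn w A u v := by
  refine ⟨.of_sew hS, ?_⟩
  rintro ⟨p, hp⟩
  obtain ⟨b, hub, hbv⟩ := exists_connIn_sew p hp v.2
  by_cases h : u = b
  · rwa [h]
  · exact .trans (.of_adj (sew_adj.2 ⟨h, hub⟩) (hp u p.start_mem_support) hbv.mem_left) hbv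

lemma rip_eq_bot_iff : rip w S = ⊥ ↔ ∀ u v, u ≠ v → ¬ ConnIn w S u v := by
  constructor
  · rintro h u v hne ⟨p, hp⟩
    cases p with
    | nil => exact hne rfl
    | @cons _ b _ hab q =>
      have : (rip w S).Adj ⟨u, hp u (by simp)⟩ ⟨b, hp b (by simp)⟩ := hab
      rw [h] at this
      exact this
  · intro h
    ext u v
    simp only [SimpleGraph.bot_adj, iff_false]
    exact fun huv => h u v (fun e => huv.ne (Subtype.ext e)) (.of_adj huv u.2 v.2)

/-- Every set `{x | c x ≤ c u}` contains the color class of `0`, so sewing through that class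
preserves the connectivity tested for the higher colors. -/
lemma isPathColoring_succ_iff {n : ℕ} {c : I → Fin (n + 1)} :
    IsPathColoring w c ↔ rip w {x | c x = 0} = ⊥ ∧
      IsPathColoring (sew w {x | c x = 0})
        (fun x : ({x | c x = 0}ᶜ : Set I) => (c x).pred x.2) := by
  rw [isPathColoring_iff, rip_eq_bot_iff, isPathColoring_iff]
  have key (u v : ({x | c x = 0}ᶜ : Set I)) :
      ConnIn (sew w {x | c x = 0}) {x | (c x).pred x.2 ≤ (c u).pred u.2} u v ↔
        ConnIn w {x | c x ≤ c u} u v := by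
    rw [← connIn_sew_iff (S := {x | c x = 0})]
    · simp only [Fin.pred_le_pred_iff, Set.preimage_ofPred_eq]
    · intro x hx
      rw [Set.mem_ofPred_eq] at hx ⊢
      rw [hx]
      exact Fin.zero_le _
  have zero (u : I) (hu : c u = 0) : {x | c x ≤ c u} = {x | c x = 0} := by
    simp [hu]
  constructor
  · refine fun h => ⟨fun u v hne huv => ?_, fun u v hne huv hc => ?_⟩
    · have hu : c u = 0 := huv.mem_left
      have hv : c v = 0 := huv.mem_right
      exact h u v hne (hu.trans hv.symm) (by rwa [zero u hu])
    · exact h u v (fun e => hne (Subtype.ext e)) (Fin.pred_inj.1 huv) ((key u v).1 hc)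
  · rintro ⟨h0, h1⟩ u v hne huv hc
    by_cases hu : c u = 0
    · exact h0 u v hne (by rwa [zero u hu] at hc)
    · refine h1 ⟨u, hu⟩ ⟨v, fun hv => hu (huv.trans hv)⟩ (by simpa using hne) ?_ ((key _ _).2 hc)
      simp only [huv]

end Sew

open Classical in
lemma zetaCoprod_single (𝕜 : Type*) [Field 𝕜] (n : ℕ) {I : Type*} (w : SimpleGraph I)
    (c : I → Fin n) :
    zetaCoprod 𝕜 n c (Finsupp.single w 1) = if IsPathColoring w c then 1 else 0 := by
  induction n generalizing I with
  | zero =>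
    have : IsEmpty I := ⟨fun x => (c x).elim0⟩
    have h1 : w = ⊥ := Subsingleton.elim _ _
    have h2 : IsPathColoring w c := fun u => (c u).elim0
    simp [zetaCoprod, zeta, h1, h1 ▸ h2]
  | succ n ih =>
    simp only [zetaCoprod, coprod, LinearMap.comp_apply, Finsupp.lift_apply, zero_smul,
      Finsupp.sum_single_index, one_smul, TensorProduct.map_tmul, ih, LinearMap.mul'_apply, zeta,
      isPathColoring_succ_iff (w := w), ite_and]
    split_ifs <;> simp

lemma basicInvariant_single (𝕜 : Type*) [Field 𝕜] {I : Type*} [Fintype I] [DecidableEq I]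
    (w : SimpleGraph I) (n : ℕ) :
    basicInvariant 𝕜 (Finsupp.single w 1) n =
      (({c : I → Fin n | IsPathColoring w c}.ncard : ℕ) : 𝕜) := by
  classical
  simp only [basicInvariant, zetaCoprod_single, Finset.sum_boole]
  rw [Set.ncard_eq_toFinset_card', Set.toFinset_ofPred]


/-! ### Partitioning forests and path colorings -/

section Forests

variable {I : Type*} {w : SimpleGraph I} {parent parent' : I → Option I} {q : Option I}
  {J : Set I} {n : ℕ} {c : I → Fin n}

lemma IsTreeOn.congr (h : IsTreeOn w parent q J) (hp : ∀ x ∈ J, parent x = parent' x) :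
    IsTreeOn w parent' q J := by
  induction h with
  | node q J v hv hroot hsub ih =>
    exact .node q J v hv (hp v hv ▸ hroot) fun K hK =>
      ih K hK fun x hx => hp x (hK.subset hx).1

lemma IsTreeOn.lt_of_strictlyCompatible (hc : StrictlyCompatible parent c)
    (h : IsTreeOn w parent q J) {r : I} (hr : q = some r) {x : I} (hx : x ∈ J) : c x < c r := by
  induction h generalizing r x with
  | node q J v hv hroot hsub ih =>
    have hvr : c v < c r := hc _ _ (hroot.trans hr)
    by_cases hxv : x = v
    · rwa [hxv]
    · exact (ih _ (isComponent_setOf ⟨hx, hxv⟩) rfl (ConnIn.refl ⟨hx, hxv⟩)).trans hvr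

/-- The topmost tree vertex on the walk is the witness: a walk avoiding the root stays in one
component below it. -/
lemma IsTreeOn.exists_lt (hc : StrictlyCompatible parent c) (h : IsTreeOn w parent q J)
    {u v : I} (p : w.Walk u v) (hp : ∀ x ∈ p.support, x ∈ J) (hne : u ≠ v) (huv : c u = c v) :
    ∃ x ∈ p.support, c u < c x := by
  induction h with
  | node q J r hr hroot hsub ih =>
    by_cases hrp : r ∈ p.support
    · refine ⟨r, hrp, ?_⟩
      have key {x : I} (hx : x ∈ p.support) (hxr : x ≠ r) : c x < c r :=
        (hsub _ (isComponent_setOf ⟨hp x hx, hxr⟩)).lt_of_strictlyCompatible hc rfl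
          (ConnIn.refl ⟨hp x hx, hxr⟩)
      -- At most one end is the root, and the ends share their color, so bounding the other end
      -- suffices.
      by_cases hur : u = r
      · exact huv ▸ key p.end_mem_support (hur ▸ hne.symm)
      · exact key p.start_mem_support hur
    · obtain ⟨K, hK, hpK⟩ := exists_isComponent (A := J \ {r}) p
        fun x hx => ⟨hp x hx, fun e => hrp (e ▸ hx)⟩
      exact ih K hK hpK

lemma IsPartitioningForest.isPathColoring (h : IsPartitioningForest w parent)
    (hc : StrictlyCompatible parent c) : IsPathColoring w c := by
  intro u v p _ hne huv
  obtain ⟨K, hK, hpK⟩ := exists_isComponent (A := Set.univ) p fun _ _ => Set.mem_univ _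
  exact (h K hK).exists_lt hc p hpK hne huv

/-- Two different roots of `J` would each have a color smaller than the other. -/
lemma IsTreeOn.eq_of_strictlyCompatible (hc : StrictlyCompatible parent c)
    (hc' : StrictlyCompatible parent' c) (h : IsTreeOn w parent q J)
    (h' : IsTreeOn w parent' q J) {x : I} (hx : x ∈ J) : parent x = parent' x := by
  induction h generalizing x with
  | node q J v hv hroot hsub ih =>
    cases h' with
    | node _ _ v' hv' hroot' hsub' =>
      obtain rfl : v = v' := by
        by_contra hne
        have h1 := (hsub _ (isComponent_setOf ⟨hv', Ne.symm hne⟩)).lt_of_strictlyCompatible hc rfl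
          (ConnIn.refl ⟨hv', Ne.symm hne⟩)
        have h2 := (hsub' _ (isComponent_setOf ⟨hv, hne⟩)).lt_of_strictlyCompatible hc' rfl
          (ConnIn.refl ⟨hv, hne⟩)
        exact lt_asymm h1 h2
      by_cases hxv : x = v
      · rw [hxv, hroot, hroot']
      · have hK := isComponent_setOf (w := w) (A := J \ {v}) ⟨hx, hxv⟩
        exact ih _ hK (hsub' _ hK) (ConnIn.refl ⟨hx, hxv⟩)

lemma IsPartitioningForest.eq_of_strictlyCompatible (h : IsPartitioningForest w parent)
    (h' : IsPartitioningForest w parent') (hc : StrictlyCompatible parent c)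
    (hc' : StrictlyCompatible parent' c) : parent = parent' :=
  funext fun x => (h _ (isComponent_setOf (Set.mem_univ x))).eq_of_strictlyCompatible hc hc'
    (h' _ (isComponent_setOf (Set.mem_univ x))) (ConnIn.refl (Set.mem_univ x))

/-- Strictly compatible trees on the components of `w_{|A}` can be glued. -/
lemma exists_isTreeOn_components {A : Set I}
    (h : ∀ K, IsComponent w A K → ∃ parent, IsTreeOn w parent q K ∧
      ∀ x ∈ K, ∀ r, parent x = some r → c x < c r) :
    ∃ parent, (∀ K, IsComponent w A K → IsTreeOn w parent q K) ∧
      ∀ x ∈ A, ∀ r, parent x = some r → c x < c r := by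
  choose! T hT hTc using h
  refine ⟨fun x => T {y | ConnIn w A x y} x, fun K hK => (hT K hK).congr fun x hx => ?_,
    fun x hx => hTc _ (isComponent_setOf hx) x (ConnIn.refl hx)⟩
  rw [hK.eq_setOf hx]

lemma IsPathColoring.exists_isTreeOn [Finite I] (hc : IsPathColoring w c) (hJ : J.Nonempty)
    (hconn : ∀ x ∈ J, ∀ y ∈ J, ConnIn w J x y) (hq : ∀ r, q = some r → ∀ x ∈ J, c x < c r) :
    ∃ parent, IsTreeOn w parent q J ∧ ∀ x ∈ J, ∀ r, parent x = some r → c x < c r := by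
  classical
  induction hm : J.ncard using Nat.strong_induction_on generalizing J q with | _ m ih
  subst hm
  -- The root is a vertex of maximal color; connectedness of `J` and the path condition make the
  -- maximum strict.
  obtain ⟨v, hv, hmax⟩ := Set.exists_max_image J c J.toFinite hJ
  have hlt : ∀ x ∈ J \ {v}, c x < c v := by
    rintro x ⟨hx, hxv⟩
    refine lt_of_le_of_ne (hmax x hx) fun e => ?_
    refine isPathColoring_iff.1 hc x v hxv e ((hconn x hx v hv).mono fun y hy => ?_)
    exact (hmax y hy).trans e.ge
  obtain ⟨t, ht, htc⟩ := exists_isTreeOn_components (w := w) (q := some v) (A := J \ {v}) (c := c)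
    fun K hK => ih K.ncard
      (Set.ncard_lt_ncard ⟨fun x hx => (hK.subset hx).1, fun h => (hK.subset (h hv)).2 rfl⟩)
      hK.nonempty (fun x hx y hy => hK.connIn hx hy)
      (by rintro r ⟨⟩ x hx; exact hlt x (hK.subset hx)) rfl
  refine ⟨Function.update t v q, .node q J v hv (by simp) fun K hK => (ht K hK).congr fun x hx => ?_,
    fun x hx r hr => ?_⟩
  · rw [Function.update_of_ne (hK.subset hx).2]
  · by_cases hxv : x = v
    · subst hxv
      exact hq r (by simpa using hr) x hx
    · rw [Function.update_of_ne hxv] at hr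
      exact htc x ⟨hx, hxv⟩ r hr

lemma IsPathColoring.exists_isPartitioningForest [Finite I] (hc : IsPathColoring w c) :
    ∃ parent, IsPartitioningForest w parent ∧ StrictlyCompatible parent c := by
  obtain ⟨t, ht, htc⟩ := exists_isTreeOn_components (w := w) (q := none) (A := Set.univ) (c := c)
    fun K hK => hc.exists_isTreeOn hK.nonempty (fun x hx y hy => hK.connIn hx hy) (by simp)
  exact ⟨t, ht, fun x r => htc x (Set.mem_univ x) r⟩

lemma ncard_isPathColoring [Finite I] (w : SimpleGraph I) (n : ℕ) :
    {c : I → Fin n | IsPathColoring w c}.ncard =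
      {pc : (I → Option I) × (I → Fin n) | IsPartitioningForest w pc.1 ∧
          StrictlyCompatible pc.1 pc.2}.ncard := by
  have : {c : I → Fin n | IsPathColoring w c} =
      Prod.snd '' {pc : (I → Option I) × (I → Fin n) | IsPartitioningForest w pc.1 ∧
          StrictlyCompatible pc.1 pc.2} := by
    ext c
    constructor
    · intro h
      obtain ⟨t, ht⟩ := h.exists_isPartitioningForest
      exact ⟨(t, c), ht, rfl⟩
    · rintro ⟨⟨t, c⟩, ⟨h1, h2⟩, rfl⟩
      exact h1.isPathColoring h2
  rw [this, Set.InjOn.ncard_image]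
  rintro ⟨t, c⟩ ⟨h1, h2⟩ ⟨t', c'⟩ ⟨h1', h2'⟩ (rfl : c = c')
  exact Prod.ext (h1.eq_of_strictlyCompatible h1' h2 h2') rfl

/-- Excludes cycles of the parent function; this is what later provides a leaf to remove. -/
lemma IsTreeOn.acc (h : IsTreeOn w parent q J)
    (hq : ∀ r, q = some r → Acc (fun v x => parent x = some v) r) {x : I} (hx : x ∈ J) :
    Acc (fun v x => parent x = some v) x := by
  induction h generalizing x with
  | node q J v hv hroot hsub ih =>
    have hacc : Acc (fun v x => parent x = some v) v :=
      ⟨v, fun r hr => hq r (hroot.symm.trans hr)⟩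
    by_cases hxv : x = v
    · rwa [hxv]
    · exact ih _ (isComponent_setOf ⟨hx, hxv⟩) (by rintro r ⟨⟩; exact hacc)
        (ConnIn.refl ⟨hx, hxv⟩)

lemma IsPartitioningForest.wellFounded (h : IsPartitioningForest w parent) :
    WellFounded (fun v x => parent x = some v) :=
  ⟨fun x => (h _ (isComponent_setOf (Set.mem_univ x))).acc (by simp)
    (ConnIn.refl (Set.mem_univ x))⟩

lemma isPartitioningForest_iff_of_connected (hw : w.Connected) :
    IsPartitioningForest w parent ↔ IsPartitioningTree w parent := by
  have huniv (x : I) : {y | ConnIn w Set.univ x y} = Set.univ :=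
    Set.eq_univ_of_forall fun y => ⟨(hw.preconnected x y).some, by simp⟩
  constructor
  · intro h
    obtain ⟨x⟩ := hw.nonempty
    exact h _ (isComponent_iff.2 ⟨x, Set.mem_univ x, (huniv x).symm⟩)
  · intro h K hK
    obtain ⟨x, -, rfl⟩ := isComponent_iff.1 hK
    rwa [huniv]

end Forests

/-! ### Reciprocity for order-preserving colorings of rooted forests -/

section Reciprocity

open Polynomial

lemma exists_antidifference {𝕜 : Type*} [Field 𝕜] [CharZero 𝕜] (h : 𝕜[X]) :
    ∃ H : 𝕜[X], H.eval 0 = 0 ∧ ∀ x, H.eval (x + 1) = H.eval x + h.eval x := by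
  suffices ∃ H : 𝕜[X], ∀ x, H.eval (x + 1) = H.eval x + h.eval x by
    obtain ⟨H, hH⟩ := this
    exact ⟨H - C (H.eval 0), by simp, fun x => by simp [hH]; ring⟩
  induction h using Polynomial.induction_on' with
  | add p q hp hq =>
    obtain ⟨P, hP⟩ := hp
    obtain ⟨Q, hQ⟩ := hq
    exact ⟨P + Q, fun x => by simp [hP, hQ]; ring⟩
  | monomial n a =>
    -- Bernoulli polynomials satisfy `B_{n+1}(x+1) - B_{n+1}(x) = (n+1) x^n`.
    refine ⟨C (a / (n + 1)) * (Polynomial.bernoulli (n + 1)).map (algebraMap ℚ 𝕜), fun x => ?_⟩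
    have h := congrArg (fun p => (p.map (algebraMap ℚ 𝕜)).eval x)
      (Polynomial.bernoulli_comp_one_add_X (n + 1))
    simp [Polynomial.map_comp, Polynomial.eval_comp, add_comm (1 : 𝕜)] at h
    have h0 : (n + 1 : 𝕜) ≠ 0 := by exact_mod_cast n.succ_ne_zero
    simp [h]
    field_simp

lemma sum_range_eval_of_antidifference {𝕜 : Type*} [Field 𝕜] {h H : 𝕜[X]} (h0 : H.eval 0 = 0)
    (hH : ∀ x, H.eval (x + 1) = H.eval x + h.eval x) (n : ℕ) :
    ∑ k ∈ Finset.range n, h.eval (k : 𝕜) = H.eval (n : 𝕜) := by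
  induction n with
  | zero => simp [h0]
  | succ n ih => rw [Finset.sum_range_succ, ih]; push_cast; rw [hH]

lemma sum_range_eval_neg_of_antidifference {𝕜 : Type*} [Field 𝕜] {h H : 𝕜[X]} (h0 : H.eval 0 = 0)
    (hH : ∀ x, H.eval (x + 1) = H.eval x + h.eval x) (n : ℕ) :
    ∑ k ∈ Finset.range n, h.eval (-1 - k : 𝕜) = -H.eval (-n : 𝕜) := by
  induction n with
  | zero => simp [h0]
  | succ n ih =>
    have := hH (-1 - n)
    rw [show (-1 - n + 1 : 𝕜) = -n by ring] at this
    rw [Finset.sum_range_succ, ih, this]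
    push_cast
    rw [show (-(n + 1) : 𝕜) = -1 - n by ring]
    ring


open Classical in
/-- The sum of the weights `∏ x, e x (c x)` of the maps `c` that send the relation `R` into `r`. -/
noncomputable def homSum {𝕜 : Type*} [Field 𝕜] {I α : Type*} [Fintype I] [Fintype α]
    [DecidableEq I] (R : I → I → Prop) (r : α → α → Prop) (e : I → α → 𝕜) : 𝕜 :=
  ∑ c : I → α, if ∀ x v, R x v → r (c x) (c v) then ∏ x, e x (c x) else 0

open Classical in
-- As `y` is a leaf, its color is constrained only through its parents and can be summed out first.
lemma homSum_eq_of_forall_not {𝕜 : Type*} [Field 𝕜] {I α : Type*} [Fintype I] [Fintype α]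
    [DecidableEq I] {R : I → I → Prop} (r : α → α → Prop) (e : I → α → 𝕜) {y : I}
    (hy : ∀ x, ¬ R x y) :
    homSum R r e = ∑ c : {x // x ≠ y} → α,
      if ∀ x v : {x // x ≠ y}, R x v → r (c x) (c v) then
        (∑ a, if ∀ v : {x // x ≠ y}, R y v → r a (c v) then e y a else 0) * ∏ x : {x // x ≠ y}, e x (c x)
      else 0 := by
  rw [homSum, ← (Equiv.funSplitAt y α).symm.sum_comp, Fintype.sum_prod_type_right]
  refine Finset.sum_congr rfl fun c _ => ?_
  have hval (a : α) : (Equiv.funSplitAt y α).symm (a, c) y = a := by simp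
  have hval' (a : α) (x : {x // x ≠ y}) : (Equiv.funSplitAt y α).symm (a, c) x = c x := by
    simp [x.2]
  have hcond (a : α) : (∀ x v, R x v → r ((Equiv.funSplitAt y α).symm (a, c) x)
        ((Equiv.funSplitAt y α).symm (a, c) v)) ↔
      (∀ x v : {x // x ≠ y}, R x v → r (c x) (c v)) ∧
        ∀ v : {x // x ≠ y}, R y v → r a (c v) := by
    constructor
    · refine fun h => ⟨fun x v hxv => ?_, fun v hv => ?_⟩
      · simpa only [hval'] using h x v hxv
      · simpa only [hval, hval'] using h y v hv
    · rintro ⟨h1, h2⟩ x v hxv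
      have hv : v ≠ y := fun e => hy x (e ▸ hxv)
      rw [hval' a ⟨v, hv⟩]
      by_cases hx : x = y
      · subst hx
        rw [hval]
        exact h2 ⟨v, hv⟩ hxv
      · rw [hval' a ⟨x, hx⟩]
        exact h1 ⟨x, hx⟩ ⟨v, hv⟩ hxv
  simp only [hcond, ite_and, Fintype.prod_eq_mul_prod_subtype_ne _ y, hval, hval']
  split_ifs
  · rw [Finset.sum_mul]
    exact Finset.sum_congr rfl fun a _ => by split_ifs <;> simp
  · simp

/-- The inner sum depends only on the color of the parent `v`, whose weight absorbs it as `g`. The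
scalar `s` is there for the sign: it is `1` in the strict case and `-1` in the weak one. -/
lemma homSum_eq_of_parent {𝕜 : Type*} [Field 𝕜] {I α : Type*} [Fintype I] [Fintype α]
    [DecidableEq I] {R : I → I → Prop} (r : α → α → Prop) [DecidableRel r] (e : I → α → 𝕜)
    {y : I} (hy : ∀ x, ¬ R x y) (v : {x // x ≠ y}) (hv : ∀ u : {x // x ≠ y}, R y u ↔ u = v)
    (s : 𝕜) (g : α → 𝕜) (hg : ∀ b, (∑ a, if r a b then e y a else 0) = s * g b) :
    homSum R r e = s * homSum (fun x u : {x // x ≠ y} => R x u) r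
      fun x a => (if x = v then g a else 1) * e x a := by
  rw [homSum_eq_of_forall_not r e hy, homSum, Finset.mul_sum]
  refine Finset.sum_congr rfl fun c _ => ?_
  by_cases hc : ∀ x u : {x // x ≠ y}, R x u → r (c x) (c u)
  swap
  · rw [if_neg hc, if_neg hc, mul_zero]
  rw [if_pos hc, if_pos hc]
  rw [Finset.prod_mul_distrib, Finset.prod_ite_eq' Finset.univ v fun x => g (c x),
    if_pos (Finset.mem_univ v), ← mul_assoc, ← hg]
  congr 1
  refine Finset.sum_congr rfl fun a _ => ?_
  simp only [hv, forall_eq]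

lemma homSum_eq_of_isolated {𝕜 : Type*} [Field 𝕜] {I α : Type*} [Fintype I] [Fintype α]
    [DecidableEq I] {R : I → I → Prop} (r : α → α → Prop) (e : I → α → 𝕜)
    {y : I} (hy : ∀ x, ¬ R x y) (hy' : ∀ x, ¬ R y x) :
    homSum R r e = (∑ a, e y a) * homSum (fun x u : {x // x ≠ y} => R x u) r fun x a => e x a := by
  rw [homSum_eq_of_forall_not r e hy, homSum, Finset.mul_sum]
  refine Finset.sum_congr rfl fun c _ => ?_
  by_cases hc : ∀ x u : {x // x ≠ y}, R x u → r (c x) (c u)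
  swap
  · rw [if_neg hc, if_neg hc, mul_zero]
  rw [if_pos hc, if_pos hc]
  congr 1
  exact Finset.sum_congr rfl fun a _ => if_pos fun v h => absurd h (hy' v.1)

lemma sum_fin_ite_lt {𝕜 : Type*} [Field 𝕜] {n : ℕ} (f : ℕ → 𝕜) {m : ℕ} (hm : m ≤ n) :
    (∑ a : Fin n, if (a : ℕ) < m then f a else 0) = ∑ k ∈ Finset.range m, f k := by
  rw [Fin.sum_univ_eq_sum_range (fun k => if k < m then f k else 0), ← Finset.sum_filter]
  congr 1
  ext k
  simp only [Finset.mem_filter, Finset.mem_range]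
  lia

/-- Reciprocity for the weighted colorings of a rooted forest, where `R x v` says that `v` is the
parent of `x`. -/
theorem exists_polynomial_homSum {𝕜 : Type*} [Field 𝕜] [CharZero 𝕜] {I : Type*} [Fintype I]
    [DecidableEq I] (R : I → I → Prop) (hR : ∀ x v v', R x v → R x v' → v = v')
    (hwf : WellFounded fun v x => R x v) (h : I → 𝕜[X]) :
    ∃ P : 𝕜[X],
      (∀ n : ℕ, P.eval (n : 𝕜) =
        homSum R (· < ·) fun x (a : Fin n) => (h x).eval ((a : ℕ) : 𝕜)) ∧
      ∀ n : ℕ, (-1) ^ Fintype.card I * P.eval (-(n : 𝕜)) =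
        homSum R (· ≤ ·) fun x (a : Fin n) => (h x).eval (-1 - ((a : ℕ) : 𝕜)) := by
  induction hm : Fintype.card I generalizing I with
  | zero =>
    have := Fintype.card_eq_zero_iff.1 hm
    exact ⟨1, by simp [homSum], by simp [homSum]⟩
  | succ m ih =>
    have : Nonempty I := Fintype.card_pos_iff.1 (by lia)
    have hw : IsWellFounded I fun v x => R x v := ⟨hwf⟩
    -- A child has larger rank than its parent, so a vertex of maximal rank is a leaf.
    obtain ⟨y, hy⟩ := Finite.exists_max (IsWellFounded.rank fun v x => R x v)
    have hleaf (x : I) : ¬ R x y := fun hxy =>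
      (IsWellFounded.rank_lt_of_rel (r := fun v x => R x v) hxy).not_ge (hy x)
    obtain ⟨H, H0, hH⟩ := exists_antidifference (h y)
    have hcard : Fintype.card {x // x ≠ y} = m := by simp [hm]
    have ih' := fun h' => ih (I := {x // x ≠ y}) (fun x v => R x v)
      (fun x v v' h1 h2 => Subtype.ext (hR _ _ _ h1 h2))
      (InvImage.wf Subtype.val hwf) h' hcard
    by_cases hpar : ∃ v, R y v
    · obtain ⟨v, hv⟩ := hpar
      have hvy : v ≠ y := fun e => hleaf y (e ▸ hv)
      have hiff (u : {x // x ≠ y}) : R y u ↔ u = ⟨v, hvy⟩ :=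
        ⟨fun hu => Subtype.ext (hR _ _ _ hu hv), fun e => e ▸ hv⟩
      obtain ⟨P, hP, hP'⟩ := ih'
        fun x => (if x = ⟨v, hvy⟩ then H else 1) * h x
      refine ⟨P, fun n => ?_, fun n => ?_⟩
      · rw [hP, homSum_eq_of_parent _ _ hleaf ⟨v, hvy⟩ hiff 1 fun b : Fin n => H.eval ((b : ℕ) : 𝕜)]
        · simp only [one_mul, eval_mul, apply_ite (eval _), eval_one]
        · intro b
          simp only [Fin.lt_def]
          rw [sum_fin_ite_lt (fun a => (h y).eval (a : 𝕜)) b.2.le,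
            sum_range_eval_of_antidifference H0 hH, one_mul]
      · rw [pow_succ', mul_assoc, hP', homSum_eq_of_parent _ _ hleaf ⟨v, hvy⟩ hiff (-1)
          fun b : Fin n => H.eval (-1 - ((b : ℕ) : 𝕜))]
        · simp only [eval_mul, apply_ite (eval _), eval_one]
        · intro b
          -- Reading `a ≤ b` as `a < b + 1` puts the antidifference at `-(b + 1) = -1 - b`, the
          -- reflected argument.
          simp only [Fin.le_def, ← Nat.lt_succ_iff]
          rw [sum_fin_ite_lt (fun a => (h y).eval (-1 - a : 𝕜)) b.2,
            sum_range_eval_neg_of_antidifference H0 hH]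
          push_cast
          rw [neg_one_mul, neg_add_rev, ← sub_eq_add_neg]
    · obtain ⟨P, hP, hP'⟩ := ih' fun x => h x
      push Not at hpar
      refine ⟨H * P, fun n => ?_, fun n => ?_⟩
      · rw [eval_mul, hP, homSum_eq_of_isolated _ _ hleaf hpar,
          Fin.sum_univ_eq_sum_range (fun a => (h y).eval (a : 𝕜)),
          sum_range_eval_of_antidifference H0 hH]
      · rw [eval_mul, pow_succ', mul_mul_mul_comm, hP', homSum_eq_of_isolated _ _ hleaf hpar,
          Fin.sum_univ_eq_sum_range (fun a => (h y).eval (-1 - a : 𝕜)),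
          sum_range_eval_neg_of_antidifference H0 hH, neg_one_mul]

lemma homSum_one {𝕜 : Type*} [Field 𝕜] {I α : Type*} [Fintype I] [Fintype α]
    [DecidableEq I] (R : I → I → Prop) (r : α → α → Prop) :
    homSum R r (fun _ _ => (1 : 𝕜)) =
      (({c : I → α | ∀ x v, R x v → r (c x) (c v)}.ncard : ℕ) : 𝕜) := by
  classical
  simp only [homSum, Finset.prod_const_one, Finset.sum_boole]
  rw [Set.ncard_eq_toFinset_card', Set.toFinset_ofPred]

lemma exists_polynomial_ncard_compatible (𝕜 : Type*) [Field 𝕜] [CharZero 𝕜] {I : Type*}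
    [Fintype I] [DecidableEq I] {w : SimpleGraph I} {parent : I → Option I}
    (h : IsPartitioningForest w parent) :
    ∃ P : 𝕜[X],
      (∀ n : ℕ, P.eval (n : 𝕜) =
        (({c : I → Fin n | StrictlyCompatible parent c}.ncard : ℕ) : 𝕜)) ∧
      ∀ n : ℕ, (-1) ^ Fintype.card I * P.eval (-(n : 𝕜)) =
        (({c : I → Fin n | Compatible parent c}.ncard : ℕ) : 𝕜) := by
  -- The constant weight `1` is unchanged by the reflection, so both sides are plain counts.
  obtain ⟨P, hP, hP'⟩ := exists_polynomial_homSum (𝕜 := 𝕜) (fun x v => parent x = some v)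
    (fun x v v' h1 h2 => Option.some_inj.1 (h1.symm.trans h2)) h.wellFounded fun _ => 1
  simp only [eval_one, homSum_one] at hP hP'
  exact ⟨P, hP, hP'⟩

open Classical in
lemma ncard_setOf_prod {α β : Type*} [Fintype α] [Finite β] (p : α → Prop) (q : α → β → Prop) :
    {ab : α × β | p ab.1 ∧ q ab.1 ab.2}.ncard =
      ∑ a with p a, {b | q a b}.ncard := by
  have := Fintype.ofFinite β
  simp only [Set.ncard_eq_toFinset_card', Set.toFinset_ofPred, Finset.card_filter,
    Fintype.sum_prod_type, Finset.sum_filter, ite_and]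
  exact Finset.sum_congr rfl fun a _ => by split_ifs <;> simp

end Reciprocity

end GraphHopf

theorem mainTheorem4 {𝕜 : Type*} [Field 𝕜] [CharZero 𝕜] {I : Type*} [Fintype I] [DecidableEq I]
    (w : SimpleGraph I) :
    ∃ χ : Polynomial 𝕜,
      (∀ n : ℕ, χ.eval (n : 𝕜) = GraphHopf.basicInvariant 𝕜 (Finsupp.single w 1) n) ∧
      (∀ n : ℕ, χ.eval (n : 𝕜) =
        (({c : I → Fin n | GraphHopf.IsPathColoring w c}.ncard : ℕ) : 𝕜)) ∧
      (∀ n : ℕ, χ.eval (n : 𝕜) =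
        (({pc : (I → Option I) × (I → Fin n) | GraphHopf.IsPartitioningForest w pc.1 ∧
          GraphHopf.StrictlyCompatible pc.1 pc.2}.ncard : ℕ) : 𝕜)) ∧
      (∀ n : ℕ, (-1) ^ Fintype.card I * χ.eval (-(n : 𝕜)) =
        (({pc : (I → Option I) × (I → Fin n) | GraphHopf.IsPartitioningForest w pc.1 ∧
          GraphHopf.Compatible pc.1 pc.2}.ncard : ℕ) : 𝕜)) ∧
      (-1) ^ Fintype.card I * χ.eval (-1) =
        (({t : I → Option I | GraphHopf.IsPartitioningForest w t}.ncard : ℕ) : 𝕜) ∧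
      (w.Connected → (-1) ^ Fintype.card I * χ.eval (-1) =
        (({t : I → Option I | GraphHopf.IsPartitioningTree w t}.ncard : ℕ) : 𝕜)) := by
  classical
  have hex (t : I → Option I) (ht : GraphHopf.IsPartitioningForest w t) :=
    GraphHopf.exists_polynomial_ncard_compatible 𝕜 ht
  -- `P t` is arbitrary when `t` is not a partitioning forest; the sums below are filtered
  -- accordingly.
  choose! P hP hP' using hex
  have hstrict (n : ℕ) :
      (∑ t with GraphHopf.IsPartitioningForest w t, P t).eval (n : 𝕜) =
        (({pc : (I → Option I) × (I → Fin n) | GraphHopf.IsPartitioningForest w pc.1 ∧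
          GraphHopf.StrictlyCompatible pc.1 pc.2}.ncard : ℕ) : 𝕜) := by
    rw [GraphHopf.ncard_setOf_prod _ GraphHopf.StrictlyCompatible, Polynomial.eval_finsetSum,
      Nat.cast_sum]
    exact Finset.sum_congr rfl fun t ht => hP t (Finset.mem_filter.1 ht).2 n
  have hweak (n : ℕ) :
      (-1) ^ Fintype.card I *
          (∑ t with GraphHopf.IsPartitioningForest w t, P t).eval (-(n : 𝕜)) =
        (({pc : (I → Option I) × (I → Fin n) | GraphHopf.IsPartitioningForest w pc.1 ∧
          GraphHopf.Compatible pc.1 pc.2}.ncard : ℕ) : 𝕜) := by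
    rw [GraphHopf.ncard_setOf_prod _ GraphHopf.Compatible, Polynomial.eval_finsetSum,
      Nat.cast_sum, Finset.mul_sum]
    exact Finset.sum_congr rfl fun t ht => hP' t (Finset.mem_filter.1 ht).2 n
  have hneg : (-1) ^ Fintype.card I *
      (∑ t with GraphHopf.IsPartitioningForest w t, P t).eval (-1) =
        (({t : I → Option I | GraphHopf.IsPartitioningForest w t}.ncard : ℕ) : 𝕜) := by
    -- With a single color there is exactly one coloring, compatible with every forest, so the pairs
    -- count the forests.
    have h := hweak 1
    have hone (t : I → Option I) :
        {c : I → Fin 1 | GraphHopf.Compatible t c} = Set.univ :=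
      Set.eq_univ_of_forall fun c x v _ => (Subsingleton.elim (c x) (c v)).le
    rw [GraphHopf.ncard_setOf_prod _ GraphHopf.Compatible] at h
    simp only [hone, Set.ncard_univ, Nat.card_eq_fintype_card, Fintype.card_unique,
      Finset.sum_const, smul_eq_mul, mul_one, Nat.cast_one] at h
    rw [h, Set.ncard_eq_toFinset_card', Set.toFinset_ofPred]
  refine ⟨∑ t with GraphHopf.IsPartitioningForest w t, P t, fun n => ?_, fun n => ?_, hstrict,
    hweak, hneg, fun hw => ?_⟩
  · rw [GraphHopf.basicInvariant_single, GraphHopf.ncard_isPathColoring, hstrict]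
  · rw [GraphHopf.ncard_isPathColoring, hstrict]
  · simp only [hneg, ← GraphHopf.isPartitioningForest_iff_of_connected hw]
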